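/- Let $\mathfrak V$ be a variety of algebras (the class of all algebras of a given finitary signature satisfying a given set of identities), let $\mathcal F\in\mathfrak V$ be a free $\mathfrak V$-algebra of infinite rank $\varkappa$ with basis $\mathcal B$ (so $|\mathcal B|=\varkappa$), and let $\lambda<\varkappa$ be an infinite cardinal. For $\varphi\in\mathrm{Aut}(\mathcal F)$ put $\mathrm{supp}(\varphi)=\{b\in\mathcal B:\varphi b\neq b\}$, and let $$G=\mathrm{Aut}_{\lambda,\mathcal B}(\mathcal F)=\{\varphi\in\mathrm{Aut}(\mathcal F): |\mathrm{supp}(\varphi)|\le\lambda\},$$ a subgroup of $\mathrm{Aut}(\mathcal F)$. For a subset $S$ of a group $H$, the length of $h\in H$ with respect to $S$ is the least number of elements of $S\cup S^{-1}$ whose product is $h$, and the width of $H$ with respect to $S$ is the supremum of the lengths of the elements of $H$. The group $H$ is said to be of finite $C$-width if it has finite width with respect to every generating set that is invariant under conjugation by the elements of $H$. An automorphism of $\mathcal F$ is called permutational if it maps some basis of $\mathcal F$ onto itself. Then the following hold. (1) There are a set $\mathcal C_0\subseteq\mathcal B$ of cardinality $\lambda$ and an element $\pi^*\in G$ which fixes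 $\mathcal B\setminus\mathcal C_0$ pointwise and acts on $\mathcal C_0$ as an involution without fixed points. (2) For every $\mathcal C_0\subseteq\mathcal B$ of cardinality $\lambda$ and every such $\pi^*\in G$, the automorphism $\pi^*$ is permutational and of order $2$, and its conjugacy class $C(\pi^*)$ in $G$ generates $G$ in at most four steps: $G=\langle C(\pi^*)\rangle$, $G=C(\pi^*)^4$ (every element of $G$ is a product of four elements of $C(\pi^*)$), and the width of $G$ with respect to $C(\pi^*)$ is at most $4$. (3) $G$ is a group of finite $C$-width. -/

import Mathlib

open Cardinal FirstOrder
open scoped Pointwise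

universe u v w

/-! ### Width of a group -/

section Width

variable {G : Type*} [Group G]

/-- The length of `g` with respect to `S`: the least number of factors in an expression of `g` as
a product of elements of `S ∪ S⁻¹` (`⊤` if there is no such expression). -/
noncomputable def wordLength (S : Set G) (g : G) : ℕ∞ :=
  sInf {n : ℕ∞ | ∃ l : List G, (∀ x ∈ l, x ∈ S ∪ S⁻¹) ∧ l.prod = g ∧ (l.length : ℕ∞) = n}

/-- The width of `G` with respect to `S`: the supremum of the lengths of the elements of `G`. -/
noncomputable def groupWidth (S : Set G) : ℕ∞ := ⨆ g : G, wordLength S g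

/-- `S` is invariant under all inner automorphisms of `G`. -/
def ConjInvariant (S : Set G) : Prop := ∀ g : G, ∀ s ∈ S, g * s * g⁻¹ ∈ S

/-- `G` has finite width with respect to every conjugation-invariant generating set. -/
def FiniteCWidth (G : Type*) [Group G] : Prop :=
  ∀ S : Set G, Subgroup.closure S = ⊤ → ConjInvariant S → groupWidth S < ⊤

end Width

/-! ### Varieties of algebras and free algebras

An algebraic signature is a first-order language without relation symbols; a variety is the class
of all algebras of the signature that satisfy a given set of identities. -/

section Variety

variable {L : FirstOrder.Language.{u, v}}

/-- The algebra `A` satisfies all the identities in `E`, i.e. `A` lies in the variety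
defined by `E`. -/
def InVariety (E : Set (L.Term ℕ × L.Term ℕ)) (A : Type*) [L.Structure A] : Prop :=
  ∀ p ∈ E, ∀ x : ℕ → A, p.1.realize x = p.2.realize x

/-- `F` is a free algebra of the variety defined by `E`, and `B ⊆ F` is a basis of it: `F` lies in
the variety, and every map from `B` to an algebra of the variety extends uniquely to a homomorphism.
The universe of the test algebras is large enough to contain a copy of `F` and the quotients
of the term algebra over `B`. -/
structure IsFreeBasis (E : Set (L.Term ℕ × L.Term ℕ)) {F : Type w} [L.Structure F]
    (B : Set F) : Prop where
  inVariety : InVariety E F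
  existsUnique_hom : ∀ (A : Type (max u w)) [L.Structure A], InVariety E A →
    ∀ f : B → A, ∃! φ : F →[L] A, ∀ b : B, φ b = f b

/-- The automorphism group of an algebra, with composition as multiplication. -/
instance autGroup (F : Type w) [L.Structure F] : Group (F ≃[L] F) where
  mul f g := f.comp g
  one := FirstOrder.Language.Equiv.refl L F
  inv f := f.symm
  mul_assoc _ _ _ := rfl
  one_mul _ := rfl
  mul_one _ := rfl
  inv_mul_cancel f := FirstOrder.Language.Equiv.ext fun x => f.toEquiv.symm_apply_apply x

theorem aut_mul_apply {F : Type w} [L.Structure F] (f g : F ≃[L] F) (x : F) :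
    (f * g) x = f (g x) := rfl

theorem aut_one_apply {F : Type w} [L.Structure F] (x : F) :
    (1 : F ≃[L] F) x = x := rfl

theorem aut_inv_apply_self {F : Type w} [L.Structure F] (f : F ≃[L] F) (x : F) :
    f⁻¹ (f x) = x := f.toEquiv.symm_apply_apply x

/-- The support of an automorphism with respect to `B`. -/
def autSupport {F : Type w} [L.Structure F] (B : Set F) (φ : F ≃[L] F) : Set F :=
  {b | b ∈ B ∧ φ b ≠ b}

/-- The group of automorphisms whose support in `B` has at most `lam` elements, for an infinite
cardinal `lam`. -/
def boundedAut (L : FirstOrder.Language.{u, v}) {F : Type w} [L.Structure F] (B : Set F)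
    (lam : Cardinal.{w}) (hlam : ℵ₀ ≤ lam) : Subgroup (F ≃[L] F) where
  carrier := {φ | #(autSupport B φ) ≤ lam}
  one_mem' := by
    have h : autSupport B (1 : F ≃[L] F) = ∅ := by
      ext b
      simp [autSupport, aut_one_apply]
    simp [h]
  mul_mem' := by
    intro f g hf hg
    have h : autSupport B (f * g) ⊆ autSupport B f ∪ autSupport B g := by
      rintro b ⟨hb, hne⟩
      by_cases hgb : g b = b
      · refine Or.inl ⟨hb, fun hfb => hne ?_⟩
        rw [aut_mul_apply, hgb, hfb]
      · exact Or.inr ⟨hb, hgb⟩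
    exact (mk_le_mk_of_subset h).trans ((mk_union_le _ _).trans (add_le_of_le hlam hf hg))
  inv_mem' := by
    intro f hf
    have h : autSupport B f⁻¹ ⊆ autSupport B f := by
      rintro b ⟨hb, hne⟩
      refine ⟨hb, fun hfb => hne ?_⟩
      have := aut_inv_apply_self f b
      rwa [hfb] at this
    exact (mk_le_mk_of_subset h).trans hf

/-- An automorphism of a free algebra is permutational if it maps some basis of the algebra
onto itself. -/
def IsPermutational (E : Set (L.Term ℕ × L.Term ℕ)) {F : Type w} [L.Structure F]
    (φ : F ≃[L] F) : Prop :=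
  ∃ X : Set F, IsFreeBasis E X ∧ φ '' X = X

/-- `φ` fixes `B \ C` pointwise and acts on `C` as an involution without fixed points. -/
def IsFreeInvolutionOn {F : Type w} [L.Structure F] (B C : Set F) (φ : F ≃[L] F) : Prop :=
  (∀ b ∈ B \ C, φ b = b) ∧ ∀ c ∈ C, φ c ∈ C ∧ φ c ≠ c ∧ φ (φ c) = c

end Variety

/-! Each `φ` in `G` is supported in a set `D` of `lam` basis elements whose subalgebra is preserved
by `φ` and `φ⁻¹`. Since `lam < #B`, the basis contains copies of `D` indexed by `ℤ`, with `D` as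
copy `0`. Let `σ` shift the copies by one, and let `α` act as `σ ^ n * φ * σ ^ (-n)` on copy `n` for
`n ≥ 0` and trivially on the rest of the basis. In `α * σ * α⁻¹ * σ⁻¹` everything cancels except the
action on copy `0`, so this commutator is `φ` (`exists_eq_commutator`).

The shift is a product of two reflections of `ℤ`, that is, of two basis involutions moving `lam`
elements. All such involutions are conjugate in `G` (`exists_conj_of_involutive`), so the commutator
is a product of four conjugates of `π*`. Finite `C`-width follows by writing `π*` as a word in an
arbitrary conjugation-invariant generating set. -/

/-! ### Homomorphisms of free algebras -/

section FreeAlgebra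

open FirstOrder.Language

variable {L : FirstOrder.Language.{u, v}} {E : Set (L.Term ℕ × L.Term ℕ)}

theorem InVariety.of_injective {A A' : Type*} [L.Structure A] [L.Structure A']
    (h : InVariety E A') (g : A →[L] A') (hg : Function.Injective g) : InVariety E A := by
  intro p hp x
  apply hg
  rw [← HomClass.realize_term g, ← HomClass.realize_term g]
  exact h p hp _

variable {F : Type w} [L.Structure F] {B : Set F}

/-- The universal property of a free algebra for test algebras in its own universe. -/
theorem IsFreeBasis.existsUnique_hom_same (hB : IsFreeBasis E B) (A : Type w) [L.Structure A]
    (hA : InVariety E A) (f : B → A) : ∃! φ : F →[L] A, ∀ b : B, φ b = f b := by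
  let _ : L.Structure (ULift.{u} A) := Equiv.ulift.{u}.symm.inducedStructure
  let e : A ≃[L] ULift.{u} A := Equiv.ulift.{u}.symm.inducedStructureEquiv
  have hU : InVariety E (ULift.{u} A) := hA.of_injective e.symm.toHom e.symm.injective
  obtain ⟨φ, hφ, huniq⟩ := hB.existsUnique_hom (ULift.{u} A) hU (fun b => e (f b))
  refine ⟨e.symm.toHom.comp φ, fun b => ?_, fun ψ hψ => ?_⟩
  · change e.symm (φ b) = f b
    rw [hφ b, e.symm_apply_apply]
  · have h := huniq (e.toHom.comp ψ) fun b => by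
      change e (ψ b) = e (f b)
      rw [hψ b]
    subst h
    ext x
    exact (e.symm_apply_apply (ψ x)).symm

theorem IsFreeBasis.exists_hom (hB : IsFreeBasis E B) (f : B → F) :
    ∃ φ : F →[L] F, ∀ b : B, φ b = f b :=
  (hB.existsUnique_hom_same F hB.inVariety f).exists

theorem IsFreeBasis.hom_ext (hB : IsFreeBasis E B) {φ ψ : F →[L] F}
    (h : ∀ b : B, φ b = ψ b) : φ = ψ :=
  (hB.existsUnique_hom_same F hB.inVariety fun b => ψ b).unique h fun _ => rfl

theorem IsFreeBasis.aut_ext (hB : IsFreeBasis E B) {φ ψ : F ≃[L] F}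
    (h : ∀ b : B, φ b = ψ b) : φ = ψ :=
  Language.Equiv.ext fun x =>
    DFunLike.congr_fun (hB.hom_ext (φ := φ.toHom) (ψ := ψ.toHom) h) x

/-- The homomorphism from `F` to the subalgebra generated by `B` that extends the inclusion of `B`
becomes, inside `F`, an endomorphism fixing `B`; by uniqueness it is the identity. -/
theorem IsFreeBasis.closure_eq_top (hB : IsFreeBasis E B) :
    Substructure.closure L B = ⊤ := by
  let S := Substructure.closure L B
  have hS : InVariety E S := hB.inVariety.of_injective S.subtype.toHom S.subtype.injective
  obtain ⟨φ, hφ, -⟩ := hB.existsUnique_hom_same S hS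
    (fun b => ⟨b, Substructure.subset_closure b.2⟩)
  have h : S.subtype.toHom.comp φ = Hom.id L F := hB.hom_ext fun b => by
    change ((φ b : S) : F) = b
    rw [hφ b]
  refine eq_top_iff.2 fun x _ => ?_
  have hx : ((φ x : S) : F) = x := DFunLike.congr_fun h x
  exact hx ▸ (φ x).2

theorem exists_finite_mem_closure {X : Set F} {x : F} (hx : x ∈ Substructure.closure L X) :
    ∃ s ⊆ X, s.Finite ∧ x ∈ Substructure.closure L s := by
  refine Substructure.closure_induction
    (p := fun x => ∃ s ⊆ X, s.Finite ∧ x ∈ Substructure.closure L s) hx (fun x hx => ?_) ?_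
  · exact ⟨{x}, by simpa using hx, Set.finite_singleton x, Substructure.subset_closure rfl⟩
  · intro n f xs hxs
    choose s hsX hsf hs using hxs
    refine ⟨⋃ i, s i, Set.iUnion_subset hsX, Set.finite_iUnion hsf, ?_⟩
    exact Substructure.fun_mem _ f xs fun i =>
      Substructure.closure_mono (Set.subset_iUnion s i) (hs i)

/-- Two mutually inverse endomorphisms of an algebra form an automorphism. -/
def autOfInverse [L.IsAlgebraic] (α β : F →[L] F) (h₁ : ∀ x, α (β x) = x)
    (h₂ : ∀ x, β (α x) = x) : F ≃[L] F where
  toFun := α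
  invFun := β
  left_inv := h₂
  right_inv := h₁
  map_fun' f x := α.map_fun f x
  map_rel' r _ := isEmptyElim r

/-- The automorphism of a free algebra induced by a permutation of its basis. -/
noncomputable def IsFreeBasis.permAut [L.IsAlgebraic] (hB : IsFreeBasis E B) :
    Equiv.Perm B →* (F ≃[L] F) :=
  let ext (p : Equiv.Perm B) : F →[L] F := (hB.exists_hom fun b => p b).choose
  have ext_apply (p : Equiv.Perm B) (b : B) : ext p b = p b :=
    (hB.exists_hom fun b => (p b : F)).choose_spec b
  have inverse (p q : Equiv.Perm B) (h : p * q = 1) (x : F) : ext p (ext q x) = x :=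
    DFunLike.congr_fun (hB.hom_ext (φ := (ext p).comp (ext q)) (ψ := Hom.id L F) fun b => by
      change ext p (ext q b) = b
      rw [ext_apply, ext_apply, ← Equiv.Perm.mul_apply, h, Equiv.Perm.one_apply]) x
  MonoidHom.mk'
    (fun p => autOfInverse (ext p) (ext p⁻¹) (inverse p p⁻¹ (mul_inv_cancel p))
      (inverse p⁻¹ p (inv_mul_cancel p)))
    fun p q => hB.aut_ext fun b => by
      change ext (p * q) b = ext p (ext q b)
      rw [ext_apply, ext_apply, ext_apply, Equiv.Perm.mul_apply]

@[simp]
theorem IsFreeBasis.permAut_apply [L.IsAlgebraic] (hB : IsFreeBasis E B) (p : Equiv.Perm B)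
    (b : B) : hB.permAut p b = p b :=
  (hB.exists_hom fun b => (p b : F)).choose_spec b

theorem IsFreeBasis.mk_autSupport_permAut_le [L.IsAlgebraic] (hB : IsFreeBasis E B)
    (p : Equiv.Perm B) {X : Set B} (hX : ∀ b ∉ X, p b = b) :
    #(autSupport B (hB.permAut p)) ≤ #X := by
  refine (mk_le_mk_of_subset (t := Subtype.val '' X) ?_).trans mk_image_le
  rintro b ⟨hb, hne⟩
  refine ⟨⟨b, hb⟩, ?_, rfl⟩
  by_contra h
  refine hne ((hB.permAut_apply p ⟨b, hb⟩).trans ?_)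
  rw [hX _ h]

/-- A set of at most `lam` basis elements which contains the support of `φ` and generates a
subalgebra invariant under `φ` and its inverse. -/
theorem IsFreeBasis.exists_invariant_subset (hB : IsFreeBasis E B) {lam : Cardinal.{w}}
    (hlam : ℵ₀ ≤ lam) (hle : lam ≤ #B) (φ : F ≃[L] F) (hφ : #(autSupport B φ) ≤ lam) :
    ∃ D : Set B, #D = lam ∧ (∀ b ∉ D, φ b = (b : F)) ∧
      (∀ b ∈ D, φ b ∈ Substructure.closure L (Subtype.val '' D)) ∧
      ∀ b ∈ D, φ⁻¹ b ∈ Substructure.closure L (Subtype.val '' D) := by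
  have fin (x : F) : ∃ s ⊆ B, s.Finite ∧ x ∈ Substructure.closure L s :=
    exists_finite_mem_closure (hB.closure_eq_top ▸ Substructure.mem_top x)
  choose s hsB hsf hs using fin
  -- `P` only pads the set to cardinality exactly `lam`.
  obtain ⟨P, hP⟩ := le_mk_iff_exists_set.1 hle
  let T : Set B := Subtype.val ⁻¹' autSupport B φ
  -- One pass suffices: elements of `P` or `U` outside `T` are fixed by `φ` and `φ⁻¹`, so their
  -- images need no new generators.
  let U : Set B := ⋃ b : T, Subtype.val ⁻¹' (s (φ b) ∪ s (φ⁻¹ (b : F)))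
  have hT : #T ≤ lam :=
    (mk_preimage_of_injective _ _ Subtype.val_injective).trans hφ
  have hU : #U ≤ lam := by
    refine (mk_iUnion_le_sum_mk).trans ((sum_le_mk_mul_iSup _).trans ?_)
    refine mul_le_of_le hlam hT (ciSup_le' fun b => ?_)
    refine le_trans (le_of_lt ?_) hlam
    exact (((hsf _).union (hsf _)).preimage Subtype.val_injective.injOn).lt_aleph0
  have key : ∀ b ∈ T, s (φ b) ⊆ Subtype.val '' (P ∪ T ∪ U) ∧
      s (φ⁻¹ (b : F)) ⊆ Subtype.val '' (P ∪ T ∪ U) := fun b hb =>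
    ⟨fun x hx => ⟨⟨x, hsB _ hx⟩, Or.inr (Set.mem_iUnion.2 ⟨⟨b, hb⟩, Or.inl hx⟩), rfl⟩,
     fun x hx => ⟨⟨x, hsB _ hx⟩, Or.inr (Set.mem_iUnion.2 ⟨⟨b, hb⟩, Or.inr hx⟩), rfl⟩⟩
  have fixed : ∀ b ∉ T, φ b = (b : F) := fun b hb => by
    by_contra h
    exact hb ⟨b.2, h⟩
  refine ⟨P ∪ T ∪ U, le_antisymm ?_ ?_, fun b hb => fixed b fun h => hb (Or.inl (Or.inr h)),
    fun b hb => ?_, fun b hb => ?_⟩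
  · exact (mk_union_le _ _).trans (add_le_of_le hlam
      ((mk_union_le _ _).trans (add_le_of_le hlam hP.le hT)) hU)
  · exact hP.symm.le.trans (mk_le_mk_of_subset
      (Set.subset_union_left.trans Set.subset_union_left))
  · by_cases hbT : b ∈ T
    · exact Substructure.closure_mono (key b hbT).1 (hs _)
    · rw [fixed b hbT]
      exact Substructure.subset_closure ⟨b, hb, rfl⟩
  · by_cases hbT : b ∈ T
    · exact Substructure.closure_mono (key b hbT).2 (hs _)
    · have h := aut_inv_apply_self φ (b : F)
      rw [fixed b hbT] at h
      rw [h]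
      exact Substructure.subset_closure ⟨b, hb, rfl⟩

end FreeAlgebra

/-! ### Automorphisms as commutators -/

section Swindle

open FirstOrder.Language

variable {L : FirstOrder.Language.{u, v}} {E : Set (L.Term ℕ × L.Term ℕ)}
  {F : Type w} [L.Structure F] {B : Set F}

/-- If `σ` shifts infinitely many disjoint copies of `D`, then an automorphism that fixes
`B \ D` and leaves the subalgebra generated by `D` invariant is a commutator with `σ`. -/
theorem IsFreeBasis.exists_eq_commutator [L.IsAlgebraic] (hB : IsFreeBasis E B) (φ : F ≃[L] F)
    (D : Set B) (hfix : ∀ b ∉ D, φ b = (b : F))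
    (hinv : ∀ b ∈ D, φ b ∈ Substructure.closure L (Subtype.val '' D))
    (hinv' : ∀ b ∈ D, φ⁻¹ b ∈ Substructure.closure L (Subtype.val '' D))
    (e : D × ℤ ↪ B) (he : ∀ d : D, e (d, 0) = d) (σ : F ≃[L] F)
    (hσ : ∀ d i, σ (e (d, i)) = e (d, i + 1)) (hσ' : ∀ b ∉ Set.range e, σ b = (b : F)) :
    ∃ α : F ≃[L] F, (∀ b ∉ Set.range e, α b = (b : F)) ∧ φ = α * σ * α⁻¹ * σ⁻¹ := by
  have hpow (d : D) (n : ℕ) : (σ ^ n) (d : F) = e (d, (n : ℤ)) := by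
    induction n with
    | zero => simp [he, aut_one_apply]
    | succ n ih => rw [pow_succ', aut_mul_apply, ih, hσ]; push_cast; rfl
  let j : D × ℕ → B := fun x => e (x.1, (x.2 : ℤ))
  have hj : Function.Injective j := fun x y h => by
    have := e.injective h
    simp only [Prod.mk.injEq, Nat.cast_inj] at this
    exact Prod.ext this.1 this.2
  -- The endomorphism acting as `σ ^ n * ψ * σ ^ (-n)` on copy `n ≥ 0`; `ψ = φ` and `ψ = φ⁻¹` give
  -- `α` and its inverse.
  have spread (ψ : F ≃[L] F) : ∃ A : F →[L] F,
      (∀ (d : D) (n : ℕ), A (e (d, (n : ℤ))) = (σ ^ n) (ψ d)) ∧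
      ∀ b ∉ Set.range j, A b = (b : F) := by
    obtain ⟨A, hA⟩ := hB.exists_hom
      (Function.extend j (fun x => (σ ^ x.2) (ψ x.1)) Subtype.val)
    refine ⟨A, fun d n => ?_, fun b hb => ?_⟩
    · rw [hA]
      exact hj.extend_apply _ _ (d, n)
    · rw [hA]
      exact Function.extend_apply' _ _ _ hb
  have onClosure (A : F →[L] F) (ψ : F ≃[L] F)
      (hA : ∀ (d : D) (n : ℕ), A (e (d, (n : ℤ))) = (σ ^ n) (ψ d)) (n : ℕ) (x : F)
      (hx : x ∈ Substructure.closure L (Subtype.val '' D)) :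
      A ((σ ^ n) x) = (σ ^ n) (ψ x) := by
    refine Hom.eqOn_closure (f := A.comp (σ ^ n).toHom) (g := (σ ^ n * ψ).toHom) ?_ hx
    rintro _ ⟨d, hd, rfl⟩
    change A ((σ ^ n) d) = (σ ^ n) (ψ d)
    rw [hpow ⟨d, hd⟩, hA]
  obtain ⟨A, hA, hA'⟩ := spread φ
  obtain ⟨A₁, hA₁, hA₁'⟩ := spread φ⁻¹
  have inverse (P Q : F →[L] F) (ψ χ : F ≃[L] F) (hψ : ψ * χ = 1)
      (hP : ∀ (d : D) (n : ℕ), P (e (d, (n : ℤ))) = (σ ^ n) (ψ d))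
      (hQ : ∀ (d : D) (n : ℕ), Q (e (d, (n : ℤ))) = (σ ^ n) (χ d))
      (hP' : ∀ b ∉ Set.range j, P b = (b : F)) (hQ' : ∀ b ∉ Set.range j, Q b = (b : F))
      (hχ : ∀ b ∈ D, χ b ∈ Substructure.closure L (Subtype.val '' D)) (x : F) :
      P (Q x) = x := by
    refine DFunLike.congr_fun (hB.hom_ext (φ := P.comp Q) (ψ := Hom.id L F) fun b => ?_) x
    change P (Q b) = b
    by_cases hb : b ∈ Set.range j
    · obtain ⟨⟨d, n⟩, rfl⟩ := hb
      change P (Q (e (d, (n : ℤ)))) = e (d, (n : ℤ))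
      rw [hQ, onClosure P ψ hP n _ (hχ d d.2), ← aut_mul_apply ψ χ, hψ, aut_one_apply, hpow]
    · rw [hQ' b hb, hP' b hb]
  let α : F ≃[L] F := autOfInverse A A₁
    (inverse A A₁ φ φ⁻¹ (mul_inv_cancel φ) hA hA₁ hA' hA₁' hinv')
    (inverse A₁ A φ⁻¹ φ (inv_mul_cancel φ) hA₁ hA hA₁' hA' hinv)
  have hα (d : D) (n : ℕ) : α (e (d, (n : ℤ))) = (σ ^ n) (φ d) := hA d n
  have hα' (b : B) (hb : b ∉ Set.range j) : α b = b := hA' b hb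
  have notMem_of_neg (d : D) (i : ℤ) (hi : i < 0) : e (d, i) ∉ Set.range j := by
    rintro ⟨⟨d', n⟩, h⟩
    have := congrArg Prod.snd (e.injective h)
    simp only at this
    omega
  have hφe (d : D) (i : ℤ) (hi : i ≠ 0) : φ (e (d, i)) = e (d, i) := by
    refine hfix _ fun h => hi ?_
    exact (congrArg Prod.snd (e.injective (he ⟨_, h⟩))).symm
  refine ⟨α, fun b hb => hα' b fun ⟨x, hx⟩ => hb ⟨_, hx⟩, ?_⟩
  suffices h : φ * (σ * α) = α * σ by
    rw [← h]; group
  refine hB.aut_ext fun b => ?_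
  rw [aut_mul_apply, aut_mul_apply, aut_mul_apply]
  by_cases hb : b ∈ Set.range e
  · obtain ⟨⟨d, i⟩, rfl⟩ := hb
    rw [hσ]
    -- The case `i = -1` is where `σ` enters copy `0` and `φ` appears; below it `α` and `φ` are
    -- trivial.
    obtain hi | rfl | hi : 0 ≤ i ∨ i = -1 ∨ i + 1 < 0 := by omega
    · obtain ⟨n, rfl⟩ := Int.eq_ofNat_of_zero_le hi
      have h1 := hα d (n + 1)
      push_cast at h1
      rw [h1, hα, ← aut_mul_apply σ, ← pow_succ']
      -- `φ` fixes copy `n + 1` of `D`, hence the subalgebra it generates, which contains `σ ^ (n +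
      -- 1) (φ d)`.
      refine Hom.eqOn_closure (f := φ.toHom.comp (σ ^ (n + 1)).toHom)
        (g := (σ ^ (n + 1)).toHom) ?_ (hinv d d.2)
      rintro _ ⟨d', hd', rfl⟩
      change φ ((σ ^ (n + 1)) d') = (σ ^ (n + 1)) d'
      rw [hpow ⟨d', hd'⟩, hφe _ _ (by omega)]
    · have h0 := hα d 0
      rw [hα' _ (notMem_of_neg d _ (by omega)), hσ]
      simp only [Nat.cast_zero, pow_zero, aut_one_apply] at h0
      rw [he] at h0
      simp only [Int.reduceNeg, neg_add_cancel, he, h0]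
    · rw [hα' _ (notMem_of_neg d _ (by omega)), hσ, hα' _ (notMem_of_neg d _ hi),
        hφe _ _ (by omega)]
  · have hj' : b ∉ Set.range j := fun ⟨x, hx⟩ => hb ⟨_, hx⟩
    have hD : b ∉ D := fun h => hb ⟨_, he ⟨b, h⟩⟩
    rw [hα' b hj', hσ' b hb, hα' b hj', hfix b hD]

end Swindle

/-! ### Involutions of a set -/

section Involutions

open Equiv

/-- The conjugator swaps `m a` with `m' a`, which is a well-defined permutation because the ranges
are disjoint. -/
theorem exists_conj_viaEmbedding_of_disjoint {α β : Type*} (r : Perm α) (m m' : α ↪ β)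
    (hd : ∀ a a', m a ≠ m' a') :
    ∃ c : Perm β, (∀ b ∉ Set.range m ∪ Set.range m', c b = b) ∧
      c * r.viaEmbedding m * c⁻¹ = r.viaEmbedding m' := by
  let ι : α ⊕ α ↪ β := ⟨Sum.elim m m', m.injective.sumElim m'.injective hd⟩
  let c := Perm.viaEmbedding (Equiv.sumComm α α) ι
  have hc (a : α) : c (m a) = m' a :=
    Perm.viaEmbedding_apply (Equiv.sumComm α α) ι (Sum.inl a)
  have hc' (a : α) : c (m' a) = m a :=
    Perm.viaEmbedding_apply (Equiv.sumComm α α) ι (Sum.inr a)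
  have hfix : ∀ b ∉ Set.range m ∪ Set.range m', c b = b := fun b hb =>
    Perm.viaEmbedding_apply_of_notMem (Equiv.sumComm α α) ι b
      (by simpa [ι, Set.Sum.elim_range] using hb)
  refine ⟨c, hfix, mul_inv_eq_of_eq_mul (Equiv.ext fun b => ?_)⟩
  simp only [Perm.mul_apply]
  by_cases h : b ∈ Set.range m
  · obtain ⟨a, rfl⟩ := h
    rw [Perm.viaEmbedding_apply, hc, hc, Perm.viaEmbedding_apply]
  · rw [Perm.viaEmbedding_apply_of_notMem _ _ _ h]
    by_cases h' : b ∈ Set.range m'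
    · obtain ⟨a, rfl⟩ := h'
      rw [hc', Perm.viaEmbedding_apply_of_notMem]
      rintro ⟨a', h'⟩
      exact hd _ _ h'.symm
    · rw [hfix b (by rintro (h₁ | h₁) <;> contradiction), Perm.viaEmbedding_apply_of_notMem _ _ _ h']

/-- The involution of `X × Bool` that flips the second coordinate. -/
def flipBool (X : Type*) : Perm (X × Bool) := Equiv.prodCongr (Equiv.refl X) Equiv.boolNot

/-- A normal form: a linear order selects the smaller point of each 2-cycle, and these points are
indexed by `lam.out`. -/
theorem exists_eq_viaEmbedding_flipBool {β : Type w} {lam : Cardinal.{w}} (hlam : ℵ₀ ≤ lam)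
    (r : Perm β) (hr : Function.Involutive r) (hcard : #{b | r b ≠ b} = lam) :
    ∃ m : lam.out × Bool ↪ β, r = (flipBool lam.out).viaEmbedding m := by
  classical
  let _ : LinearOrder β := linearOrderOfSTO WellOrderingRel
  let H : Set β := {b | b < r b}
  have hH : #H = lam := by
    refine le_antisymm (hcard ▸ mk_le_mk_of_subset fun b hb => (ne_of_lt hb).symm) ?_
    -- With fewer than `lam` cycles, the moved points `H ∪ r '' H` would number fewer than `lam`, as
    -- `lam` is infinite.
    by_contra! hlt
    have hsub : {b | r b ≠ b} ⊆ H ∪ r '' H := fun b hb => by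
      rcases lt_or_gt_of_ne hb with h | h
      · refine Or.inr ⟨r b, ?_, hr b⟩
        change r b < r (r b)
        rwa [hr b]
      · exact Or.inl h
    have h := (mk_le_mk_of_subset hsub).trans (mk_union_le _ _)
    rw [hcard] at h
    exact absurd h (not_le.2 (add_lt_of_lt hlam hlt (mk_image_le.trans_lt hlt)))
  obtain ⟨g⟩ : Nonempty (lam.out ≃ H) := Cardinal.eq.1 (by rw [mk_out, hH])
  have hgr (x y : lam.out) : (g x : β) ≠ r (g y) := fun h => by
    have h1 : (g x : β) < r (g x) := (g x).2
    have h2 : (g y : β) < r (g y) := (g y).2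
    rw [h, hr] at h1
    exact lt_asymm h1 h2
  let f : lam.out × Bool → β := fun x => if x.2 then g x.1 else r (g x.1)
  have hf : Function.Injective f := by
    rintro ⟨x, a⟩ ⟨y, b⟩ h
    cases a <;> cases b <;> simp only [f, Bool.false_eq_true, if_true, if_false] at h
    · rw [g.injective (Subtype.ext (r.injective h))]
    · exact absurd h.symm (hgr _ _)
    · exact absurd h (hgr _ _)
    · rw [g.injective (Subtype.ext h)]
  refine ⟨⟨f, hf⟩, Equiv.ext fun b => ?_⟩
  by_cases hb : b ∈ Set.range f
  · obtain ⟨⟨x, a⟩, rfl⟩ := hb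
    refine Eq.trans ?_ (Perm.viaEmbedding_apply (flipBool lam.out) ⟨f, hf⟩ (x, a)).symm
    cases a
    · exact hr _
    · rfl
  · rw [Perm.viaEmbedding_apply_of_notMem _ ⟨f, hf⟩ b hb]
    by_contra hne
    rcases lt_or_gt_of_ne hne with h | h
    · have hrb : r b ∈ H := by
        change r b < r (r b)
        rwa [hr b]
      refine hb ⟨(g.symm ⟨r b, hrb⟩, false), ?_⟩
      simp [f, hr b]
    · exact hb ⟨(g.symm ⟨b, h⟩, true), by simp [f]⟩

/-- Involutions moving exactly `lam` points of a larger set are conjugate by a permutation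
moving at most `lam` points. -/
theorem exists_conj_of_involutive {β : Type w} {lam : Cardinal.{w}} (hlam : ℵ₀ ≤ lam)
    (hlt : lam < #β) (r r' : Perm β) (hr : Function.Involutive r)
    (hr' : Function.Involutive r') (hcard : #{b | r b ≠ b} = lam)
    (hcard' : #{b | r' b ≠ b} = lam) :
    ∃ c : Perm β, ∃ X : Set β, #X ≤ lam ∧ (∀ b ∉ X, c b = b) ∧ c * r * c⁻¹ = r' := by
  obtain ⟨m, rfl⟩ := exists_eq_viaEmbedding_flipBool hlam r hr hcard
  obtain ⟨m', rfl⟩ := exists_eq_viaEmbedding_flipBool hlam r' hr' hcard'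
  have hprod : #(lam.out × Bool) = lam := by
    rw [mk_prod, mk_out, lift_id', mk_bool, lift_ofNat]
    exact mul_eq_left hlam ((natCast_lt_aleph0 (n := 2)).le.trans hlam) two_ne_zero
  have hrange (k : lam.out × Bool ↪ β) : #(Set.range k) ≤ lam := mk_range_le.trans hprod.le
  have hU : #(Set.range m ∪ Set.range m' : Set β) ≤ lam :=
    (mk_union_le _ _).trans (add_le_of_le hlam (hrange m) (hrange m'))
  have : Infinite β := infinite_iff.2 (hlam.trans hlt.le)
  -- The ranges of `m` and `m'` may overlap, so the conjugation passes through a third copy disjoint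
  -- from both.
  obtain ⟨k⟩ : Nonempty (lam.out × Bool ↪ ↥(Set.range m ∪ Set.range m')ᶜ) := by
    refine (Cardinal.le_def _ _).1 ?_
    rw [hprod, mk_compl_of_infinite _ (hU.trans_lt hlt)]
    exact hlt.le
  let k' := k.trans (Function.Embedding.subtype _)
  have hk (x) : k' x ∉ Set.range m ∪ Set.range m' := (k x).2
  obtain ⟨c, hc, hconj⟩ := exists_conj_viaEmbedding_of_disjoint (flipBool lam.out) m k'
    fun a a' h => hk a' (Or.inl ⟨a, h⟩)
  obtain ⟨c', hc', hconj'⟩ := exists_conj_viaEmbedding_of_disjoint (flipBool lam.out) k' m'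
    fun a a' h => hk a (Or.inr ⟨a', h.symm⟩)
  refine ⟨c' * c, Set.range m ∪ Set.range k' ∪ Set.range m', ?_, fun b hb => ?_, ?_⟩
  · exact (mk_union_le _ _).trans (add_le_of_le hlam
      ((mk_union_le _ _).trans (add_le_of_le hlam (hrange m) (hrange k'))) (hrange m'))
  · simp only [Set.mem_union, not_or] at hb
    rw [Perm.mul_apply, hc b (by simp only [Set.mem_union]; tauto),
      hc' b (by simp only [Set.mem_union]; tauto)]
  · rw [← hconj', ← hconj]
    group

/-- The copies of a set of cardinality `lam` inside a larger set. -/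
theorem exists_embedding_prod_int {β : Type w} {lam : Cardinal.{w}} (hlam : ℵ₀ ≤ lam)
    (hlt : lam < #β) (D : Set β) (hD : #D = lam) :
    ∃ e : D × ℤ ↪ β, ∀ d : D, e (d, 0) = d := by
  have : Infinite β := infinite_iff.2 (hlam.trans hlt.le)
  have hprod : #(D × ℤ) = lam := by
    rw [mk_prod, hD, lift_id', mk_int, lift_aleph0]
    exact mul_eq_left hlam hlam aleph0_ne_zero
  obtain ⟨k⟩ : Nonempty (D × ℤ ↪ ↥Dᶜ) := by
    refine (Cardinal.le_def _ _).1 ?_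
    rw [hprod, mk_compl_of_infinite _ (hD.trans_lt hlt)]
    exact hlt.le
  let f : D × ℤ → β := fun x => if x.2 = 0 then x.1 else k x
  suffices hf : Function.Injective f from ⟨⟨f, hf⟩, fun d => by simp [f]⟩
  rintro ⟨d, i⟩ ⟨d', i'⟩ h
  simp only [f] at h
  split_ifs at h with h1 h2 h2
  · exact Prod.ext (Subtype.ext h) (h1.trans h2.symm)
  · exact absurd d.2 (h ▸ (k (d', i')).2)
  · exact absurd d'.2 (h ▸ (k (d, i)).2)
  · exact k.injective (Subtype.ext h)

/-- The permutation of `X × ℤ` that reflects the second coordinate by `i ↦ k - i`. -/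
def reflectInt (X : Type*) (k : ℤ) : Perm (X × ℤ) :=
  Equiv.prodCongr (Equiv.refl X) (Equiv.subLeft k)

theorem reflectInt_apply {X : Type*} (k : ℤ) (x : X) (i : ℤ) :
    reflectInt X k (x, i) = (x, k - i) := rfl

theorem reflectInt_involutive (X : Type*) (k : ℤ) : Function.Involutive (reflectInt X k) :=
  fun ⟨x, i⟩ => by simp [reflectInt_apply]

theorem mk_moved_viaEmbedding_reflectInt {β : Type w} {lam : Cardinal.{w}} (hlam : ℵ₀ ≤ lam)
    {D : Set β} (hD : #D = lam) (e : D × ℤ ↪ β) (k : ℤ) :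
    #{b | (reflectInt D k).viaEmbedding e b ≠ b} = lam := by
  refine le_antisymm ?_ ?_
  · have hsub : {b | (reflectInt D k).viaEmbedding e b ≠ b} ⊆
        Set.range e := fun b hb => by
      by_contra h
      exact hb (Perm.viaEmbedding_apply_of_notMem _ _ _ h)
    refine (mk_le_mk_of_subset hsub).trans (mk_range_le.trans (le_of_eq ?_))
    rw [mk_prod, hD, lift_id', mk_int, lift_aleph0]
    exact mul_eq_left hlam hlam aleph0_ne_zero
  · rw [← hD]
    refine mk_le_of_injective
      -- The index `|k| + 1` is positive while its reflection `k - (|k| + 1)` is negative, so it is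
      -- moved.
      (f := fun d : D => (⟨e (d, (k.natAbs : ℤ) + 1), fun h => ?_⟩ : {b | _ ≠ b})) fun d d' h => ?_
    · rw [Perm.viaEmbedding_apply] at h
      have : k - ((k.natAbs : ℤ) + 1) = k.natAbs + 1 := congrArg Prod.snd (e.injective h)
      omega
    · exact congrArg Prod.fst (e.injective (congrArg Subtype.val h))

theorem involutive_viaEmbedding {α β : Type*} (r : Perm α) (hr : Function.Involutive r)
    (e : α ↪ β) : Function.Involutive (r.viaEmbedding e) := by
  intro b
  by_cases h : b ∈ Set.range e
  · obtain ⟨a, rfl⟩ := h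
    rw [Perm.viaEmbedding_apply, Perm.viaEmbedding_apply, hr]
  · rw [Perm.viaEmbedding_apply_of_notMem _ _ _ h, Perm.viaEmbedding_apply_of_notMem _ _ _ h]

end Involutions

/-! ### Width and powers of a conjugacy class -/

section WidthBounds

variable {G : Type*} [Group G]

/-- A word over `S ∪ S⁻¹` can be conjugated letter by letter without changing its length. -/
theorem ConjInvariant.exists_list_of_mem_pow {S : Set G} (hS : ConjInvariant S) (l : List G)
    (hl : ∀ x ∈ l, x ∈ S ∪ S⁻¹) (k : ℕ) (g : G) (hg : g ∈ conjugatesOf l.prod ^ k) :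
    ∃ l' : List G, (∀ x ∈ l', x ∈ S ∪ S⁻¹) ∧ l'.prod = g ∧ l'.length = k * l.length := by
  induction k generalizing g with
  | zero =>
    rw [pow_zero, Set.mem_one] at hg
    exact ⟨[], by simp, by simp [hg], by simp⟩
  | succ k ih =>
    rw [pow_succ] at hg
    obtain ⟨a, ha, b, hb, rfl⟩ := Set.mem_mul.1 hg
    obtain ⟨l', hl', rfl, hlen⟩ := ih a ha
    obtain ⟨c, rfl⟩ := isConj_iff.1 (show IsConj l.prod b from hb)
    refine ⟨l' ++ l.map (MulAut.conj c), fun x hx => ?_, ?_, ?_⟩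
    · rcases List.mem_append.1 hx with hx | hx
      · exact hl' x hx
      · obtain ⟨y, hy, rfl⟩ := List.mem_map.1 hx
        rcases hl y hy with h | h
        · exact Or.inl (hS c y h)
        · refine Or.inr ?_
          have := hS c _ (Set.mem_inv.1 h)
          rw [Set.mem_inv, MulAut.conj_apply]
          simpa [mul_assoc] using this
    · rw [List.prod_append, ← map_list_prod, MulAut.conj_apply]
    · simp [hlen, add_mul]

theorem ConjInvariant.groupWidth_le {S : Set G} (hS : ConjInvariant S) (l : List G)
    (hl : ∀ x ∈ l, x ∈ S ∪ S⁻¹) (k : ℕ) (hk : conjugatesOf l.prod ^ k = Set.univ) :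
    groupWidth S ≤ (k * l.length : ℕ) := by
  refine iSup_le fun g => ?_
  obtain ⟨l', hl', hprod, hlen⟩ :=
    hS.exists_list_of_mem_pow l hl k g (hk ▸ Set.mem_univ g)
  exact sInf_le ⟨l', hl', hprod, by rw [hlen]⟩

theorem conjInvariant_conjugatesOf (a : G) : ConjInvariant (conjugatesOf a) := by
  intro g s hs
  exact IsConj.trans (show IsConj a s from hs) (isConj_iff.2 ⟨g, rfl⟩)

theorem groupWidth_conjugatesOf_le {a : G} {k : ℕ} (hk : conjugatesOf a ^ k = Set.univ) :
    groupWidth (conjugatesOf a) ≤ k := by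
  simpa using (conjInvariant_conjugatesOf a).groupWidth_le [a]
    (fun x hx => Or.inl (List.mem_singleton.1 hx ▸ mem_conjugatesOf_self)) k (by simpa using hk)

/-- If `a` is a word of length `n` over `S ∪ S⁻¹`, every element of `G` is one of length `k * n`. -/
theorem finiteCWidth_of_conjugatesOf_pow {a : G} {k : ℕ}
    (hk : conjugatesOf a ^ k = Set.univ) : FiniteCWidth G := by
  intro S hgen hS
  have ha : a ∈ (Subgroup.closure S).toSubmonoid := hgen ▸ Subgroup.mem_top a
  rw [Subgroup.closure_toSubmonoid] at ha
  obtain ⟨l, hl, rfl⟩ := Submonoid.exists_list_of_mem_closure ha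
  exact (hS.groupWidth_le l hl k hk).trans_lt (ENat.natCast_lt_top _)

theorem closure_conjugatesOf_eq_top {a : G} {k : ℕ} (hk : conjugatesOf a ^ k = Set.univ) :
    Subgroup.closure (conjugatesOf a) = ⊤ := by
  refine eq_top_iff.2 fun g _ => ?_
  obtain ⟨l, hl, rfl, -⟩ := (conjInvariant_conjugatesOf a).exists_list_of_mem_pow [a]
    (fun x hx => Or.inl (List.mem_singleton.1 hx ▸ mem_conjugatesOf_self)) k g (by simp [hk])
  refine Subgroup.list_prod_mem _ fun x hx => ?_
  rcases hl x hx with h | h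
  · exact Subgroup.subset_closure h
  · exact (Subgroup.inv_mem_iff _).1 (Subgroup.subset_closure (Set.mem_inv.1 h))

end WidthBounds

/-! ### Free involutions -/

section FreeInvolutions

open FirstOrder.Language

variable {L : FirstOrder.Language.{u, v}} {E : Set (L.Term ℕ × L.Term ℕ)}
  {F : Type w} [L.Structure F] {B : Set F}

/-- A free involution on `C` is induced by an involution of the basis that moves exactly the
elements of `C`. -/
theorem IsFreeInvolutionOn.exists_perm [L.IsAlgebraic] (hB : IsFreeBasis E B) {C : Set F}
    (hC : C ⊆ B) {π : F ≃[L] F} (hπ : IsFreeInvolutionOn B C π) :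
    ∃ r : Equiv.Perm B, Function.Involutive r ∧ #{b | r b ≠ b} = #C ∧ π = hB.permAut r := by
  have hmem (b : B) : π b ∈ B := by
    by_cases h : (b : F) ∈ C
    · exact hC (hπ.2 b h).1
    · rw [hπ.1 b ⟨b.2, h⟩]
      exact b.2
  let f : B → B := fun b => ⟨π b, hmem b⟩
  have hf : Function.Involutive f := fun b => Subtype.ext <| by
    change π (π b) = b
    by_cases h : (b : F) ∈ C
    · exact (hπ.2 b h).2.2
    · rw [hπ.1 b ⟨b.2, h⟩, hπ.1 b ⟨b.2, h⟩]
  refine ⟨hf.toPerm f, hf, ?_, hB.aut_ext fun b => (hB.permAut_apply (hf.toPerm f) b).symm⟩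
  have hset : {b : B | hf.toPerm f b ≠ b} = (Subtype.val ⁻¹' C : Set B) := by
    ext b
    refine ⟨fun h => ?_, fun h h' => (hπ.2 b h).2.1 (congrArg Subtype.val h')⟩
    by_contra hb
    exact h (Subtype.ext (hπ.1 b ⟨b.2, hb⟩))
  rw [hset]
  exact mk_preimage_of_injective_of_subset_range _ _ Subtype.val_injective
    (by simpa using hC)

theorem IsFreeBasis.exists_isFreeInvolutionOn [L.IsAlgebraic] (hB : IsFreeBasis E B)
    {lam : Cardinal.{w}} (hlam : ℵ₀ ≤ lam) (hle : lam ≤ #B) :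
    ∃ C ⊆ B, #C = lam ∧ ∃ π : boundedAut L B lam hlam,
      IsFreeInvolutionOn B C (π : F ≃[L] F) := by
  have hprod : #(lam.out × Bool) = lam := by
    rw [mk_prod, mk_out, lift_id', mk_bool, lift_ofNat]
    exact mul_eq_left hlam ((natCast_lt_aleph0 (n := 2)).le.trans hlam) two_ne_zero
  obtain ⟨m⟩ : Nonempty (lam.out × Bool ↪ B) := by
    refine (Cardinal.le_def _ _).1 ?_
    rwa [hprod]
  let r := (flipBool lam.out).viaEmbedding m
  have hr (x : lam.out × Bool) : hB.permAut r (m x) = m (flipBool _ x) := by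
    rw [hB.permAut_apply, Equiv.Perm.viaEmbedding_apply]
  have hrange : #(Set.range m) = lam := (mk_range_eq m m.injective).trans hprod
  refine ⟨Subtype.val '' Set.range m, by simp, ?_, ⟨hB.permAut r, ?_⟩, ?_, ?_⟩
  · rw [mk_image_eq Subtype.val_injective, hrange]
  · exact (hB.mk_autSupport_permAut_le r
      fun b hb => Equiv.Perm.viaEmbedding_apply_of_notMem _ _ _ hb).trans hrange.le
  · rintro b ⟨hb, hbC⟩
    refine (hB.permAut_apply r ⟨b, hb⟩).trans ?_
    exact congrArg (Subtype.val : B → F)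
      (Equiv.Perm.viaEmbedding_apply_of_notMem _ _ _ fun h => hbC ⟨_, h, rfl⟩)
  · rintro _ ⟨_, ⟨⟨x, a⟩, rfl⟩, rfl⟩
    rw [hr]
    refine ⟨⟨_, ⟨_, rfl⟩, rfl⟩, fun h => ?_, ?_⟩
    · have := congrArg Prod.snd (m.injective (Subtype.ext h))
      cases a <;> simp [flipBool] at this
    · rw [hr]
      cases a <;> rfl

theorem IsFreeInvolutionOn.isPermutational (hB : IsFreeBasis E B) {C : Set F}
    (hC : C ⊆ B) {π : F ≃[L] F} (hπ : IsFreeInvolutionOn B C π) : IsPermutational E π := by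
  have hmem (b : F) (hb : b ∈ B) : π b ∈ B ∧ π (π b) = b := by
    by_cases h : b ∈ C
    · exact ⟨hC (hπ.2 b h).1, (hπ.2 b h).2.2⟩
    · rw [hπ.1 b ⟨hb, h⟩, hπ.1 b ⟨hb, h⟩]
      exact ⟨hb, rfl⟩
  refine ⟨B, hB, Set.Subset.antisymm ?_ fun b hb => ⟨π b, (hmem b hb).1, (hmem b hb).2⟩⟩
  rintro _ ⟨b, hb, rfl⟩
  exact (hmem b hb).1

theorem IsFreeInvolutionOn.orderOf_eq_two (hB : IsFreeBasis E B) {C : Set F}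
    (hne : C.Nonempty) {π : F ≃[L] F} (hπ : IsFreeInvolutionOn B C π) : orderOf π = 2 := by
  refine orderOf_eq_prime ?_ ?_
  · refine hB.aut_ext fun b => ?_
    rw [pow_two, aut_mul_apply, aut_one_apply]
    by_cases h : (b : F) ∈ C
    · exact (hπ.2 b h).2.2
    · rw [hπ.1 b ⟨b.2, h⟩, hπ.1 b ⟨b.2, h⟩]
  · rintro rfl
    obtain ⟨c, hc⟩ := hne
    exact (hπ.2 c hc).2.1 rfl

/-- Every element of the bounded automorphism group is a product of four conjugates of a given
involution of the basis that moves exactly `lam` elements. -/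
theorem IsFreeBasis.conjugatesOf_pow_four [L.IsAlgebraic] (hB : IsFreeBasis E B)
    {lam : Cardinal.{w}} (hlam : ℵ₀ ≤ lam) (hlt : lam < #B)
    (π : boundedAut L B lam hlam) (r : Equiv.Perm B) (hr : Function.Involutive r)
    (hcard : #{b | r b ≠ b} = lam) (hπ : (π : F ≃[L] F) = hB.permAut r) :
    conjugatesOf π ^ 4 = Set.univ := by
  have mem_of (p : Equiv.Perm B) (X : Set B) (hX : #X ≤ lam) (h : ∀ b ∉ X, p b = b) :
      hB.permAut p ∈ boundedAut L B lam hlam := (hB.mk_autSupport_permAut_le p h).trans hX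
  have conj (p : Equiv.Perm B) (hp : Function.Involutive p) (hpc : #{b | p b ≠ b} = lam) :
      ∃ ρ : boundedAut L B lam hlam, (ρ : F ≃[L] F) = hB.permAut p ∧ IsConj π ρ := by
    obtain ⟨c, X, hX, hc, hconj⟩ := exists_conj_of_involutive hlam hlt r p hr hp hcard hpc
    refine ⟨⟨hB.permAut p, mem_of p _ hpc.le fun b hb => not_not.1 hb⟩, rfl,
      isConj_iff.2 ⟨⟨hB.permAut c, mem_of c X hX hc⟩, Subtype.ext ?_⟩⟩
    change hB.permAut c * (π : F ≃[L] F) * (hB.permAut c)⁻¹ = hB.permAut p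
    rw [hπ, ← hconj, map_mul, map_mul, map_inv]
  refine Set.eq_univ_of_forall fun φ => ?_
  obtain ⟨D, hD, hfix, hinv, hinv'⟩ :=
    hB.exists_invariant_subset hlam hlt.le (φ : F ≃[L] F) φ.2
  obtain ⟨e, he⟩ := exists_embedding_prod_int hlam hlt D hD
  let s (k : ℤ) : Equiv.Perm B := (reflectInt D k).viaEmbedding e
  have hs (k : ℤ) : ∃ ρ : boundedAut L B lam hlam,
      (ρ : F ≃[L] F) = hB.permAut (s k) ∧ IsConj π ρ :=
    conj _ (involutive_viaEmbedding _ (reflectInt_involutive D k) e)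
      (mk_moved_viaEmbedding_reflectInt hlam hD e k)
  obtain ⟨ρ, hρ, hρc⟩ := hs 0
  obtain ⟨τ, hτ, hτc⟩ := hs (-1)
  have hinvol (k : ℤ) (x : boundedAut L B lam hlam)
      (hx : (x : F ≃[L] F) = hB.permAut (s k)) : x⁻¹ = x := by
    refine inv_eq_of_mul_eq_one_right (Subtype.ext ?_)
    change (x : F ≃[L] F) * x = 1
    rw [hx, ← map_mul, ← map_one hB.permAut]
    exact congrArg _ (Equiv.ext (involutive_viaEmbedding _ (reflectInt_involutive D k) e))
  have hsfix (k : ℤ) (b : B) (hb : b ∉ Set.range e) : s k b = b :=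
    Equiv.Perm.viaEmbedding_apply_of_notMem _ _ _ hb
  obtain ⟨α, hα, hcomm⟩ := hB.exists_eq_commutator (φ : F ≃[L] F) D hfix hinv hinv' e he
    (hB.permAut (s 0 * s (-1)))
    (fun d i => by
      rw [hB.permAut_apply, Equiv.Perm.mul_apply]
      simp only [s, Equiv.Perm.viaEmbedding_apply, reflectInt_apply]
      rw [show (0 : ℤ) - (-1 - i) = i + 1 by ring])
    (fun b hb => by
      rw [hB.permAut_apply, Equiv.Perm.mul_apply, hsfix _ _ hb, hsfix _ _ hb])
  have hαmem : α ∈ boundedAut L B lam hlam := by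
    have hsub : autSupport B α ⊆ Set.range fun x => (e x : F) := by
      rintro b ⟨hb, hne⟩
      by_contra h
      exact hne (hα ⟨b, hb⟩ fun ⟨x, hx⟩ => h ⟨x, congrArg Subtype.val hx⟩)
    refine (mk_le_mk_of_subset hsub).trans (mk_range_le.trans ?_)
    rw [mk_prod, hD, lift_id', mk_int, lift_aleph0]
    exact (mul_eq_left hlam hlam aleph0_ne_zero).le
  let a : boundedAut L B lam hlam := ⟨α, hαmem⟩
  -- As `ρ` and `τ` are involutions, the factor `(ρ * τ)⁻¹` of the commutator is `τ * ρ`.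
  have hφ : φ = a * ρ * a⁻¹ * (a * τ * a⁻¹) * τ * ρ := by
    have h : φ = a * (ρ * τ) * a⁻¹ * (ρ * τ)⁻¹ := by
      refine Subtype.ext (hcomm.trans ?_)
      rw [map_mul, ← hρ, ← hτ]
      rfl
    rw [h, mul_inv_rev, hinvol _ ρ hρ, hinvol _ τ hτ]
    group
  rw [hφ, pow_succ, pow_succ, pow_two]
  refine Set.mul_mem_mul (Set.mul_mem_mul (Set.mul_mem_mul ?_ ?_) hτc) hρc
  · exact hρc.trans (isConj_iff.2 ⟨a, rfl⟩)
  · exact hτc.trans (isConj_iff.2 ⟨a, rfl⟩)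

end FreeInvolutions

theorem mainTheorem2 {L : FirstOrder.Language.{u, v}} [L.IsAlgebraic] (E : Set (L.Term ℕ × L.Term ℕ))
    {F : Type w} [L.Structure F] (B : Set F) (hB : IsFreeBasis E B)
    (κ lam : Cardinal.{w}) (hκ : #B = κ) (hlam : ℵ₀ ≤ lam) (hlt : lam < κ) :
    (∃ C ⊆ B, #C = lam ∧ ∃ π : boundedAut L B lam hlam,
      IsFreeInvolutionOn B C (π : F ≃[L] F)) ∧
    (∀ C ⊆ B, #C = lam → ∀ π : boundedAut L B lam hlam,
      IsFreeInvolutionOn B C (π : F ≃[L] F) →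
        IsPermutational E (π : F ≃[L] F) ∧ orderOf π = 2 ∧
        Subgroup.closure (conjugatesOf π) = ⊤ ∧
        conjugatesOf π ^ 4 = Set.univ ∧
        groupWidth (conjugatesOf π) ≤ 4) ∧
    FiniteCWidth (boundedAut L B lam hlam) := by
  subst hκ
  have pow_four (C : Set F) (hC : C ⊆ B) (hCc : #C = lam) (π : boundedAut L B lam hlam)
      (hπ : IsFreeInvolutionOn B C (π : F ≃[L] F)) : conjugatesOf π ^ 4 = Set.univ := by
    obtain ⟨r, hr, hrc, hπr⟩ := hπ.exists_perm hB hC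
    exact hB.conjugatesOf_pow_four hlam hlt π r hr (hrc.trans hCc) hπr
  have hex := hB.exists_isFreeInvolutionOn hlam hlt.le
  refine ⟨hex, fun C hC hCc π hπ => ?_, ?_⟩
  · have h4 := pow_four C hC hCc π hπ
    have hne : C.Nonempty := by
      rw [← Set.nonempty_coe_sort, ← mk_ne_zero_iff, hCc]
      exact (aleph0_pos.trans_le hlam).ne'
    refine ⟨hπ.isPermutational hB hC, ?_, closure_conjugatesOf_eq_top h4, h4,
      groupWidth_conjugatesOf_le h4⟩
    rw [← Subgroup.orderOf_coe]
    exact hπ.orderOf_eq_two hB hne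
  · obtain ⟨C, hC, hCc, π, hπ⟩ := hex
    exact finiteCWidth_of_conjugatesOf_pow (pow_four C hC hCc π hπ)
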